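/- Let $\alpha>0$ and $\bar f_\infty\in\mathbb R$. Let $B$ be a standard Brownian motion and let $X$ be the Ornstein–Uhlenbeck process solving $$dX_t=-\alpha X_t\,dt+\alpha^{3/2}\,dB_t,\qquad t\ge 0,$$ with continuous paths and with $X_0\sim N(0,\alpha^2)$ independent of $B$. Put $X^*_t:=\int_0^t X_s\,ds$ and $Y_t:=e^{-\bar f_\infty t}(1+X^*_t)$. Then $Y$ is a Gaussian process, and for all $s,t\ge 0$ $$\operatorname{Cov}(Y_s,Y_t)=W(s,t):=e^{-\bar f_\infty(s+t)}\bigl(\alpha\min(s,t)-e^{-\alpha\max(s,t)}\sinh(\alpha\min(s,t))\bigr).$$ Let moreover $N\ge 0$, let $t_1,\dots,t_N>0$ be distinct times to maturity, and let $D_{t_1},\dots,D_{t_N}\in\mathbb R$ be observed prices. Then there is exactly one $\zeta\in\mathbb R^N$ such that the Smith–Wilson discount factor $$\bar D_t:=e^{-\bar f_\infty t}+\sum_{i=1}^N W(t,t_i)\,\zeta_i$$ satisfies $\bar D_{t_i}=D_{t_i}$ for $i=1,\dots,N$, and, with this $\zeta$, for every $t\ge 0$ $$\bar D_t=\mathbb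 E\bigl[Y_t\,\big|\,Y_{t_i}=D_{t_i};\ i=1,\dots,N\bigr].$$ Here the right-hand side is the value at $(D_{t_1},\dots,D_{t_N})$ of the continuous version of the function $y\mapsto\mathbb E[Y_t\mid (Y_{t_1},\dots,Y_{t_N})=y]$ on $\mathbb R^N$; such a continuous version exists and is unique. -/

import Mathlib

open MeasureTheory ProbabilityTheory
open scoped NNReal

/-- The Wilson kernel with convergence speed `α` and ultimate forward rate `f`. -/
noncomputable def wilsonKernel (α f s t : ℝ) : ℝ :=
  Real.exp (-f * (s + t)) *
    (α * min s t - Real.exp (-α * max s t) * Real.sinh (α * min s t))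

/-- The Smith-Wilson discount factor at time `t`, for the maturities `T i` and the weights `ζ i`. -/
noncomputable def smithWilsonDiscount {N : ℕ} (α f : ℝ) (T : Fin N → ℝ≥0) (ζ : Fin N → ℝ)
    (t : ℝ≥0) : ℝ :=
  Real.exp (-f * t) + ∑ i, wilsonKernel α f t (T i) * ζ i

/-- The weights `ζ` fit the observed prices `D`: the Smith-Wilson discount factor at each
maturity `T i` equals `D i`. -/
def IsSmithWilsonFit {N : ℕ} (α f : ℝ) (T : Fin N → ℝ≥0) (D ζ : Fin N → ℝ) : Prop :=
  ∀ i, smithWilsonDiscount α f T ζ (T i) = D i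

/-- The integrated process: the integral of the path of `X` over `[0, t]`. -/
noncomputable def integratedProcess {Ω : Type*} (X : ℝ≥0 → Ω → ℝ) (t : ℝ≥0) (ω : Ω) : ℝ :=
  ∫ s in (0 : ℝ)..t, X s.toNNReal ω

/-- `X` is a (continuous) solution of `dX = -α X dt + α ^ (3/2) dB`, where `B` is a standard Brownian
motion, with initial value `X 0 ∼ N(0, α ^ 2)` independent of `B`. The stochastic differential
equation is written in integrated form; as its diffusion coefficient is constant, its stochastic
integral over `[0, t]` is `α ^ (3/2) * (B t - B 0)`. -/
structure IsOrnsteinUhlenbeck {Ω : Type*} [MeasurableSpace Ω] (α : ℝ) (B X : ℝ≥0 → Ω → ℝ)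
    (μ : Measure Ω) : Prop where
  brownian : IsBrownianReal B μ
  initial_law : HasLaw (X 0) (gaussianReal 0 (Real.toNNReal (α ^ 2))) μ
  initial_indep : IndepFun (X 0) (fun ω t ↦ B t ω) μ
  continuous_paths : ∀ᵐ ω ∂μ, Continuous (fun t ↦ X t ω)
  sde : ∀ᵐ ω ∂μ, ∀ t : ℝ≥0,
    X t ω = X 0 ω + (∫ s in (0 : ℝ)..t, -α * X s.toNNReal ω)
      + α ^ (3 / 2 : ℝ) * (B t ω - B 0 ω)

/-- The process `Y t = exp (-f t) * (1 + X* t)`, where `X*` is the integral of `X`. -/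
noncomputable def discountProcess {Ω : Type*} (f : ℝ) (X : ℝ≥0 → Ω → ℝ) (t : ℝ≥0) (ω : Ω) : ℝ :=
  Real.exp (-f * t) * (1 + integratedProcess X t ω)

/-- `g` is a continuous version of the function `y ↦ E[Z | V = y]`, the latter being, for almost
every value `y` of `V`, the mean of the regular conditional distribution of `Z` given `V = y`. -/
structure IsContinuousCondMean {Ω : Type*} [MeasurableSpace Ω] {N : ℕ} (μ : Measure Ω)
    [IsFiniteMeasure μ] (Z : Ω → ℝ) (V : Ω → Fin N → ℝ) (g : (Fin N → ℝ) → ℝ) : Prop where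
  continuous : Continuous g
  ae_eq : ∀ᵐ y ∂(μ.map V), g y = ∫ z, z ∂(condDistrib Z V μ y)

/-!
Write `X*` for the integral of `X` and `φ t u = (1 - exp (-α (t - u)⁺)) / α`. Along each path the
integrated stochastic differential equation is a linear ordinary differential equation for `X*`,
and variation of constants gives
`X* t = φ t 0 * X 0 + α ^ (3/2) * ∫ u in 0..t, exp (-α (t - u)) * (B u - B 0)`
(`integratedProcess_eq`). Summation by parts turns the last integral into the limit of the sums
`∑ φ t (u k) * (B (u (k+1)) - B (u k))` (`tendsto_sum_responseKernel_mul_increment`), that is, into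
the Wiener integral of `φ t`, without any stochastic integration theory.

A linear combination `∑ c i * X* (τ i)` is therefore an almost sure limit, along one common grid, of
sums of independent centred Gaussian variables, and the variances of these sums are Riemann sums.
So it is centred Gaussian with variance `α² (∑ c i φ (τ i) 0)² + α³ ∫ (∑ c i φ (τ i) u)² du`
(`IsOrnsteinUhlenbeck.hasLaw_sum_integratedProcess`). This one formula gives
* that `X*`, and with it `Y`, is a Gaussian process;
* by polarization and an elementary integral, the Wilson kernel as covariance
  (`responseKernel_gram`);
* the positive definiteness of the Wilson matrix at distinct positive maturities: just before the
  latest maturity with a nonzero weight only one of the terms `c i φ (τ i)` is nonzero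
  (`integral_sq_sum_responseKernel_pos`).

Invertibility of the Wilson matrix `S` is the existence and uniqueness of the fit. Writing the
vector `W(t, t i)` as `a S`, the residual `Y t - ∑ a i * Y (t i)` is uncorrelated with the observed
values, hence independent of them, so the conditional mean is affine with slopes `a`
(`HasGaussianLaw.isContinuousCondMean`); at `D` it equals the Smith-Wilson discount factor as
`a (D - m) = a S ζ`. The law of the observed values charges every nonempty open set, since a linear
bijection makes them independent with unit variance (`HasGaussianLaw.isOpenPosMeasure_map`), so
two continuous versions coincide.
-/

open scoped Matrix

/-! ### Riemann sums -/

open Filter Topology in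
/-- Riemann sums on the uniform grid of `[0, M]`, with weight `w` integrated exactly over each cell
and the continuous factor `g` evaluated at an arbitrary tag of the cell. -/
theorem tendsto_sum_mul_integral {M : ℝ} (hM : 0 ≤ M) {g w : ℝ → ℝ}
    (hg : ContinuousOn g (Set.Icc 0 M)) (hw : IntervalIntegrable w volume 0 M) (ξ : ℕ → ℕ → ℝ)
    (hξ : ∀ n k : ℕ, k < n + 1 → ξ n k ∈ Set.Icc (M * k / (n + 1)) (M * (k + 1) / (n + 1))) :
    Tendsto (fun n : ℕ ↦ ∑ k ∈ Finset.range (n + 1),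
      g (ξ n k) * ∫ u in (M * k / (n + 1))..(M * (k + 1) / (n + 1)), w u)
      atTop (𝓝 (∫ u in (0 : ℝ)..M, g u * w u)) := by
  have hsub : ∀ n k : ℕ, k < n + 1 →
      Set.Icc (M * k / (n + 1)) (M * (k + 1) / (n + 1)) ⊆ Set.Icc 0 M := by
    intro n k hk
    have hk' : (k : ℝ) + 1 ≤ n + 1 := by exact_mod_cast hk
    apply Set.Icc_subset_Icc
    · positivity
    · rw [div_le_iff₀ (by positivity)]; gcongr
  have hle : ∀ n k : ℕ, M * k / (n + 1) ≤ M * (k + 1) / ((n : ℝ) + 1) := by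
    intro n k; gcongr; linarith
  have hmesh : Tendsto (fun n : ℕ ↦ M / ((n : ℝ) + 1)) atTop (𝓝 0) := by
    have := (tendsto_one_div_add_atTop_nhds_zero_nat (𝕜 := ℝ)).const_mul M
    simpa [div_eq_mul_inv] using this
  have hsub' : ∀ n k : ℕ, k < n + 1 →
      Set.uIcc (M * k / (n + 1)) (M * (k + 1) / ((n : ℝ) + 1)) ⊆ Set.uIcc 0 M := by
    intro n k hk
    rw [Set.uIcc_of_le hM, Set.uIcc_of_le (hle n k)]
    exact hsub n k hk
  have hwk : ∀ n k : ℕ, k < n + 1 →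
      IntervalIntegrable w volume (M * k / (n + 1)) (M * (k + 1) / ((n : ℝ) + 1)) :=
    fun n k hk ↦ hw.mono_set (hsub' n k hk)
  have hgw : IntervalIntegrable (fun u ↦ g u * w u) volume 0 M :=
    hw.continuousOn_mul (by rwa [Set.uIcc_of_le hM])
  have hsplit : ∀ (n : ℕ) (h : ℝ → ℝ), IntervalIntegrable h volume 0 M →
      ∑ k ∈ Finset.range (n + 1), ∫ u in (M * k / (n + 1))..(M * (k + 1) / ((n : ℝ) + 1)), h u
        = ∫ u in (0 : ℝ)..M, h u := by
    intro n h hh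
    have := intervalIntegral.sum_integral_adjacent_intervals (μ := volume) (f := h)
      (a := fun k : ℕ ↦ M * k / ((n : ℝ) + 1)) (n := n + 1) (fun k hk ↦ by
        have := hh.mono_set (hsub' n k hk)
        simpa using this)
    push_cast at this
    rw [this]
    congr 1
    · simp
    · field_simp
  set C := ∫ u in (0 : ℝ)..M, ‖w u‖ with hC
  have hC0 : 0 ≤ C := intervalIntegral.integral_nonneg hM fun _ _ ↦ norm_nonneg _
  rw [Metric.tendsto_atTop]
  intro ε hε
  obtain ⟨δ, hδ, hgδ⟩ := Metric.uniformContinuousOn_iff.1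
    (isCompact_Icc.uniformContinuousOn_of_continuous hg) (ε / (C + 1)) (by positivity)
  obtain ⟨n₀, hn₀⟩ := eventually_atTop.1 (hmesh.eventually (gt_mem_nhds hδ))
  refine ⟨n₀, fun n hn ↦ ?_⟩
  have hmn := hn₀ n hn
  rw [Real.dist_eq, ← hsplit n _ hgw, ← Finset.sum_sub_distrib]
  have hbound : ∀ k ∈ Finset.range (n + 1),
      |g (ξ n k) * (∫ u in (M * k / (n + 1))..(M * (k + 1) / ((n : ℝ) + 1)), w u)
        - ∫ u in (M * k / (n + 1))..(M * (k + 1) / ((n : ℝ) + 1)), g u * w u|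
      ≤ ∫ u in (M * k / (n + 1))..(M * (k + 1) / ((n : ℝ) + 1)), ε / (C + 1) * ‖w u‖ := by
    intro k hk
    have hk' := Finset.mem_range.1 hk
    rw [← intervalIntegral.integral_const_mul, ← intervalIntegral.integral_sub
      ((hwk n k hk').const_mul _) (hgw.mono_set (hsub' n k hk')), ← Real.norm_eq_abs]
    refine intervalIntegral.norm_integral_le_of_norm_le (hle n k) ?_
      ((hwk n k hk').norm.const_mul _)
    refine Eventually.of_forall fun u hu ↦ ?_
    have hu' : u ∈ Set.Icc (M * k / (n + 1)) (M * (k + 1) / ((n : ℝ) + 1)) :=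
      Set.Ioc_subset_Icc_self hu
    rw [← sub_mul, norm_mul]
    gcongr
    rw [← dist_eq_norm]
    refine (hgδ _ (hsub n k hk' (hξ n k hk')) _ (hsub n k hk' hu') ?_).le
    refine (Real.dist_le_of_mem_Icc (hξ n k hk') hu').trans_lt ?_
    have : M * (k + 1) / ((n : ℝ) + 1) - M * k / (n + 1) = M / (n + 1) := by ring
    rwa [this]
  refine ((Finset.abs_sum_le_sum_abs _ _).trans (Finset.sum_le_sum hbound)).trans_lt ?_
  rw [hsplit n _ (hw.norm.const_mul _), intervalIntegral.integral_const_mul, ← hC]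
  rw [div_mul_eq_mul_div, div_lt_iff₀ (by positivity)]
  nlinarith

/-! ### The deterministic kernel of the integrated process -/

/-- The function `u ↦ (1 - exp (-α (t - u)⁺)) / α`, the response of the integrated process at time
`t` to a unit shock to `X` at time `u`. The positive part is encoded as `t - min u t`, so that the
function vanishes for `u ≥ t` and all times share one integration interval. -/
noncomputable def responseKernel (α t u : ℝ) : ℝ :=
  (1 - Real.exp (-α * (t - min u t))) / α

theorem continuous_responseKernel (α t : ℝ) : Continuous (responseKernel α t) := by
  unfold responseKernel; fun_prop

theorem responseKernel_of_le {α t u : ℝ} (h : t ≤ u) : responseKernel α t u = 0 := by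
  simp [responseKernel, h]

theorem responseKernel_of_ge {α t u : ℝ} (h : u ≤ t) :
    responseKernel α t u = (1 - Real.exp (-α * (t - u))) / α := by
  simp [responseKernel, h]

theorem responseKernel_pos {α t u : ℝ} (hα : 0 < α) (h : u < t) : 0 < responseKernel α t u := by
  rw [responseKernel_of_ge h.le]
  refine div_pos (sub_pos.2 (Real.exp_lt_one_iff.2 (by nlinarith))) hα

/-- The function `u ↦ exp (-α (t - u))` cut off at `t`. The value at `t` itself is `0`, which makes
it minus the right derivative of `responseKernel α t` at every point. -/
noncomputable def discountWeight (α t u : ℝ) : ℝ :=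
  (Set.Iio t).indicator (fun u ↦ Real.exp (-α * (t - u))) u

theorem intervalIntegrable_discountWeight (α t a b : ℝ) :
    IntervalIntegrable (discountWeight α t) volume a b := by
  have : IntervalIntegrable (fun u ↦ Real.exp (-α * (t - u))) volume a b :=
    Continuous.intervalIntegrable (by fun_prop) _ _
  exact ⟨this.1.indicator measurableSet_Iio, this.2.indicator measurableSet_Iio⟩

theorem integral_discountWeight {α : ℝ} (hα : α ≠ 0) (t : ℝ) {a b : ℝ} (hab : a ≤ b) :
    ∫ u in a..b, discountWeight α t u = responseKernel α t a - responseKernel α t b := by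
  have h := intervalIntegral.integral_eq_sub_of_hasDeriv_right_of_le hab
    (f := fun u ↦ -responseKernel α t u) (f' := discountWeight α t)
    (continuous_responseKernel α t).neg.continuousOn (fun u _ ↦ ?_)
    (intervalIntegrable_discountWeight α t a b)
  · rw [h]; ring
  rcases lt_or_ge u t with hu | hu
  · have h1 : HasDerivAt (fun u ↦ -((1 - Real.exp (-α * (t - u))) / α))
        (Real.exp (-α * (t - u))) u := by
      have := (((((hasDerivAt_id u).const_sub t).const_mul (-α)).exp.const_sub 1).div_const α).neg
      convert! this using 1
      field_simp
      simp
    have h2 : discountWeight α t u = Real.exp (-α * (t - u)) := by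
      simp [discountWeight, hu]
    rw [h2]
    refine (h1.congr_of_eventuallyEq ?_).hasDerivWithinAt
    filter_upwards [gt_mem_nhds hu] with v hv
    rw [responseKernel_of_ge hv.le]
  · have h2 : discountWeight α t u = 0 := by
      simp [discountWeight, hu]
    rw [h2]
    refine (hasDerivWithinAt_const u (Set.Ioi u) (0 : ℝ)).congr (fun v hv ↦ ?_) ?_
    · rw [responseKernel_of_le (hu.trans hv.le), neg_zero]
    · rw [responseKernel_of_le hu, neg_zero]

/-- Summation by parts. -/
theorem sum_mul_increment_eq (φ b : ℕ → ℝ) (n : ℕ) :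
    ∑ k ∈ Finset.range n, φ k * (b (k + 1) - b k)
      = φ n * b n - φ 0 * b 0 + ∑ k ∈ Finset.range n, b (k + 1) * (φ k - φ (k + 1)) := by
  rw [← Finset.sum_range_sub (fun k ↦ φ k * b k), ← Finset.sum_add_distrib]
  exact Finset.sum_congr rfl fun k _ ↦ by ring

open Filter Topology in
/-- The Wiener-type sums of `responseKernel α t` against a continuous path converge, although the
path need not have bounded variation: summation by parts moves the increments to the kernel. -/
theorem tendsto_sum_responseKernel_mul_increment {α : ℝ} (hα : α ≠ 0) {t M : ℝ} (ht : 0 ≤ t)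
    (htM : t ≤ M) {b : ℝ → ℝ} (hb : ContinuousOn b (Set.Icc 0 M)) (hb0 : b 0 = 0) :
    Tendsto (fun n : ℕ ↦ ∑ k ∈ Finset.range (n + 1), responseKernel α t (M * k / (n + 1)) *
      (b (M * (k + 1) / (n + 1)) - b (M * k / (n + 1))))
      atTop (𝓝 (∫ u in (0 : ℝ)..t, Real.exp (-α * (t - u)) * b u)) := by
  have hM := ht.trans htM
  have h := tendsto_sum_mul_integral hM hb (intervalIntegrable_discountWeight α t 0 M)
    (fun n k ↦ M * (k + 1) / (n + 1)) (fun (n k : ℕ) _ ↦ ⟨by gcongr; linarith, by simp⟩)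
  have h1 : ∫ u in (0 : ℝ)..M, b u * discountWeight α t u =
      ∫ u in (0 : ℝ)..t, Real.exp (-α * (t - u)) * b u := by
    rw [intervalIntegral.integral_of_le hM, intervalIntegral.integral_of_le ht]
    have : ∀ u, b u * discountWeight α t u =
        (Set.Iio t).indicator (fun u ↦ Real.exp (-α * (t - u)) * b u) u := by
      intro u
      by_cases hu : u < t <;> simp [discountWeight, hu, mul_comm]
    simp_rw [this]
    rw [setIntegral_indicator measurableSet_Iio, integral_Ioc_eq_integral_Ioo]
    congr 2
    ext u
    simp only [Set.mem_inter_iff, Set.mem_Ioc, Set.mem_Iio, Set.mem_Ioo]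
    grind
  rw [h1] at h
  refine h.congr fun n ↦ ?_
  have h2 := sum_mul_increment_eq
    (fun k : ℕ ↦ responseKernel α t (M * k / (n + 1))) (fun k : ℕ ↦ b (M * k / (n + 1))) (n + 1)
  push_cast at h2
  rw [h2]
  have h3 : M * ((n : ℝ) + 1) / (n + 1) = M := by field_simp
  rw [h3, responseKernel_of_le htM]
  simp only [mul_zero, zero_div, hb0, zero_mul, sub_zero, zero_add]
  refine Finset.sum_congr rfl fun k _ ↦ ?_
  rw [integral_discountWeight hα]
  gcongr; linarith

/-- The covariance of the integrated process, computed from the response kernel: the first summand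
comes from the initial value of variance `α ^ 2`, the second one from the Brownian motion with
diffusion coefficient `α ^ (3/2)`. -/
theorem responseKernel_gram {α s t M : ℝ} (hα : 0 < α) (hs : 0 ≤ s) (ht : 0 ≤ t)
    (hsM : s ≤ M) (htM : t ≤ M) :
    α ^ 2 * (responseKernel α s 0 * responseKernel α t 0)
      + α ^ 3 * ∫ u in (0 : ℝ)..M, responseKernel α s u * responseKernel α t u
      = α * min s t - Real.exp (-α * max s t) * Real.sinh (α * min s t) := by
  wlog hst : s ≤ t generalizing s t
  · have := this ht hs htM hsM (le_of_not_ge hst)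
    rw [min_comm, max_comm, ← this]
    simp_rw [mul_comm]
  have hint : ∀ a b, IntervalIntegrable
      (fun u ↦ responseKernel α s u * responseKernel α t u) volume a b := fun a b ↦
    ((continuous_responseKernel α s).mul (continuous_responseKernel α t)).intervalIntegrable a b
  have h1 : ∫ u in s..M, responseKernel α s u * responseKernel α t u = 0 := by
    rw [intervalIntegral.integral_congr (g := fun _ ↦ 0)]
    · simp
    · intro u hu
      rw [Set.uIcc_of_le hsM] at hu
      simp [responseKernel_of_le hu.1]
  have h2 : ∫ u in (0 : ℝ)..s, responseKernel α s u * responseKernel α t u =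
      (s - (1 - Real.exp (-α * s)) / α - (Real.exp (-α * (t - s)) - Real.exp (-α * t)) / α
        + (Real.exp (-α * (t - s)) - Real.exp (-α * (s + t))) / (2 * α)) / α ^ 2 := by
    rw [intervalIntegral.integral_eq_sub_of_hasDerivAt (f := fun u ↦
      (u - Real.exp (-α * (s - u)) / α - Real.exp (-α * (t - u)) / α
        + Real.exp (-α * (s + t - 2 * u)) / (2 * α)) / α ^ 2) ?_ (hint 0 s)]
    · have e : s + t - 2 * s = t - s := by ring
      simp only [e, sub_self, mul_zero, Real.exp_zero, sub_zero]
      ring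
    · intro u hu
      rw [Set.uIcc_of_le hs] at hu
      rw [responseKernel_of_ge hu.2, responseKernel_of_ge (hu.2.trans hst)]
      have d1 := (((hasDerivAt_id u).const_sub s).const_mul (-α)).exp.div_const α
      have d2 := (((hasDerivAt_id u).const_sub t).const_mul (-α)).exp.div_const α
      have d3 := ((((hasDerivAt_id u).const_mul 2).const_sub (s + t)).const_mul
        (-α)).exp.div_const (2 * α)
      have d := ((((hasDerivAt_id u).sub d1).sub d2).add d3).div_const (α ^ 2)
      convert! d using 1
      have e : Real.exp (-α * (s + t - 2 * u)) =
          Real.exp (-α * (s - u)) * Real.exp (-α * (t - u)) := by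
        rw [← Real.exp_add]; ring_nf
      simp only [id_eq, e]
      field_simp
      ring
  rw [← intervalIntegral.integral_add_adjacent_intervals (hint 0 s) (hint s M), h1, h2,
    responseKernel_of_ge hs, responseKernel_of_ge ht, min_eq_left hst, max_eq_right hst,
    Real.sinh_eq]
  have e1 : Real.exp (-α * (t - s)) = Real.exp (-α * t) * Real.exp (α * s) := by
    rw [← Real.exp_add]; ring_nf
  have e2 : Real.exp (-α * (s + t)) = Real.exp (-α * t) * Real.exp (-(α * s)) := by
    rw [← Real.exp_add]; ring_nf
  rw [e1, e2]
  simp only [sub_zero, neg_mul]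
  field_simp
  ring

/-- The response kernels of distinct positive times are linearly independent in `L²(0, M)`. -/
theorem integral_sq_sum_responseKernel_pos {α M : ℝ} (hα : 0 < α) {ι : Type*} [Fintype ι]
    {τ : ι → ℝ} (hτ : Function.Injective τ) (h0 : ∀ i, 0 < τ i) (hM : ∀ i, τ i ≤ M)
    {c : ι → ℝ} (hc : c ≠ 0) :
    0 < ∫ u in (0 : ℝ)..M, (∑ i, c i * responseKernel α (τ i) u) ^ 2 := by
  classical
  obtain ⟨j, hj⟩ := Function.ne_iff.1 hc
  have hcont : Continuous fun u ↦ (∑ i, c i * responseKernel α (τ i) u) ^ 2 :=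
    (continuous_finsetSum _ fun i _ ↦ (continuous_responseKernel α (τ i)).const_mul _).pow 2
  -- the latest time carrying a nonzero weight
  obtain ⟨m, hm, hmax⟩ := Finset.exists_max_image (Finset.univ.filter fun i ↦ c i ≠ 0) τ
    ⟨j, by simpa using hj⟩
  have hm' : c m ≠ 0 := by simpa using hm
  -- a point before `τ m` and after all the other times carrying a nonzero weight
  obtain ⟨u, hu0, hum, hu⟩ : ∃ u, 0 < u ∧ u < τ m ∧ ∀ i, i ≠ m → c i ≠ 0 → τ i ≤ u := by
    have hlt : ∀ i, i ≠ m → c i ≠ 0 → τ i < τ m := fun i hi hci ↦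
      lt_of_le_of_ne (hmax i (by simpa using hci)) fun h ↦ hi (hτ h)
    set S := (Finset.univ.filter fun i ↦ i ≠ m ∧ c i ≠ 0).image τ with hS
    by_cases hne : S.Nonempty
    · refine ⟨S.max' hne, ?_, ?_, fun i hi hci ↦ S.le_max' _ ?_⟩
      · obtain ⟨i, -, hi⟩ := Finset.mem_image.1 (S.max'_mem hne)
        rw [← hi]; exact h0 i
      · obtain ⟨i, hi', hi⟩ := Finset.mem_image.1 (S.max'_mem hne)
        simp only [Finset.mem_filter, Finset.mem_univ, true_and] at hi'
        rw [← hi]; exact hlt i hi'.1 hi'.2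
      · exact Finset.mem_image_of_mem _ (by simp [hi, hci])
    · refine ⟨τ m / 2, half_pos (h0 m), half_lt_self (h0 m), fun i hi hci ↦ (hne ?_).elim⟩
      exact ⟨τ i, Finset.mem_image_of_mem _ (by simp [hi, hci])⟩
  have hval : ∑ i, c i * responseKernel α (τ i) u = c m * responseKernel α (τ m) u := by
    refine Finset.sum_eq_single m (fun i _ hi ↦ ?_) (by simp)
    by_cases hci : c i = 0
    · simp [hci]
    · rw [responseKernel_of_le (hu i hi hci), mul_zero]
  have hMpos : 0 < M := (h0 m).trans_le (hM m)
  refine intervalIntegral.integral_pos hMpos hcont.continuousOn (fun _ _ ↦ sq_nonneg _)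
    ⟨u, ⟨hu0.le, hum.le.trans (hM m)⟩, ?_⟩
  rw [hval]
  have := (responseKernel_pos hα hum).ne'
  positivity

/-! ### Limits of centred Gaussian variables and sums of Brownian increments -/

open Filter Topology in
theorem hasLaw_gaussianReal_of_tendsto_ae {Ω : Type*} [MeasurableSpace Ω] {P : Measure Ω}
    [IsProbabilityMeasure P] {U : ℕ → Ω → ℝ} {Z : Ω → ℝ} {v : ℕ → ℝ≥0} {w : ℝ≥0}
    (hU : ∀ n, HasLaw (U n) (gaussianReal 0 (v n)) P)
    (hZ : ∀ᵐ ω ∂P, Tendsto (fun n ↦ U n ω) atTop (𝓝 (Z ω)))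
    (hv : Tendsto (fun n ↦ (v n : ℝ)) atTop (𝓝 w)) :
    HasLaw Z (gaussianReal 0 w) P := by
  have hZm : AEMeasurable Z P :=
    aemeasurable_of_tendsto_metrizable_ae atTop (fun n ↦ (hU n).aemeasurable) hZ
  refine ⟨hZm, ?_⟩
  have := Measure.isProbabilityMeasure_map hZm
  refine Measure.ext_of_charFun (funext fun t ↦ ?_)
  have h1 : Tendsto (fun n ↦ charFun (P.map (U n)) t) atTop (𝓝 (charFun (P.map Z) t)) := by
    simp_rw [charFun_apply_real]
    rw [integral_map hZm (by fun_prop)]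
    simp_rw [fun n ↦ integral_map (hU n).aemeasurable (μ := P)
      (f := fun x : ℝ ↦ Complex.exp (t * x * Complex.I)) (by fun_prop)]
    refine tendsto_integral_of_dominated_convergence (fun _ ↦ 1) (fun n ↦ ?_)
      (integrable_const _) (fun n ↦ Eventually.of_forall fun ω ↦ ?_) ?_
    · have := (hU n).aemeasurable
      exact AEMeasurable.aestronglyMeasurable (by fun_prop)
    · rw [← Complex.ofReal_mul, Complex.norm_exp_ofReal_mul_I]
    · filter_upwards [hZ] with ω hω
      have hc : Continuous fun x : ℝ ↦ Complex.exp (t * x * Complex.I) := by fun_prop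
      exact (hc.tendsto _).comp hω
  have h2 : Tendsto (fun n ↦ charFun (P.map (U n)) t) atTop
      (𝓝 (charFun (gaussianReal 0 w) t)) := by
    simp_rw [fun n ↦ (hU n).map_eq, charFun_gaussianReal]
    have hc : Continuous fun x : ℝ ↦ Complex.exp (t * (0 : ℝ) * Complex.I - x * t ^ 2 / 2) := by
      fun_prop
    exact (hc.tendsto _).comp hv
  exact tendsto_nhds_unique h1 h2

theorem hasLaw_sum_range_gaussianReal {Ω : Type*} [MeasurableSpace Ω] {P : Measure Ω}
    [IsProbabilityMeasure P] {U : ℕ → Ω → ℝ} {v : ℕ → ℝ≥0} (hindep : iIndepFun U P)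
    (hU : ∀ k, HasLaw (U k) (gaussianReal 0 (v k)) P) (n : ℕ) :
    HasLaw (fun ω ↦ ∑ k ∈ Finset.range n, U k ω)
      (gaussianReal 0 (∑ k ∈ Finset.range n, v k)) P := by
  induction n with
  | zero =>
    simp only [Finset.range_zero, Finset.sum_empty, gaussianReal_zero_var]
    exact hasLaw_dirac_of_ae_eq (Filter.Eventually.of_forall fun _ ↦ rfl)
  | succ n ih =>
    have h := hindep.indepFun_finsetSum_of_notMem₀ (fun k ↦ (hU k).aemeasurable)
      (s := Finset.range n) (i := n) (by simp)
    have e : (∑ k ∈ Finset.range n, U k) = fun ω ↦ ∑ k ∈ Finset.range n, U k ω := by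
      ext ω; simp
    rw [e] at h
    have h' := gaussianReal_add_gaussianReal_of_indepFun h ih.map_eq (hU n).map_eq
    simp_rw [Finset.sum_range_succ]
    exact ⟨ih.aemeasurable.add (hU n).aemeasurable, by simpa [Pi.add_def] using h'⟩

theorem ProbabilityTheory.IsPreBrownianReal.hasLaw_sum_increments {Ω : Type*} [MeasurableSpace Ω]
    {P : Measure Ω} [IsProbabilityMeasure P] {B : ℝ≥0 → Ω → ℝ} (hB : IsPreBrownianReal B P)
    {u : ℕ → ℝ≥0} (hu : Monotone u) (φ : ℕ → ℝ) (n : ℕ) :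
    HasLaw (fun ω ↦ ∑ k ∈ Finset.range n, φ k * (B (u (k + 1)) ω - B (u k) ω))
      (gaussianReal 0 (∑ k ∈ Finset.range n, Real.toNNReal (φ k ^ 2) * (u (k + 1) - u k))) P := by
  refine hasLaw_sum_range_gaussianReal ?_ (fun k ↦ ?_) n
  · exact (hB.hasIndepIncrements.nat hu).comp (fun k x ↦ φ k * x) fun k ↦ by fun_prop
  · have h := gaussianReal_const_mul (hB.hasLaw_sub (u (k + 1)) (u k)) (φ k)
    rw [mul_zero] at h
    have hd : nndist ((u (k + 1) : ℝ≥0) : ℝ) (u k : ℝ≥0) = u (k + 1) - u k := by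
      have hk := hu k.le_succ
      rw [← NNReal.coe_inj, coe_nndist, NNReal.coe_sub hk, Real.dist_eq,
        abs_of_nonneg (sub_nonneg.2 (NNReal.coe_le_coe.2 hk))]
    have he : (.mk (φ k ^ 2) (sq_nonneg _) : ℝ≥0) = Real.toNNReal (φ k ^ 2) :=
      (Real.toNNReal_of_nonneg (sq_nonneg _)).symm
    rw [← hd, ← he]
    exact h

/-! ### Linear combinations of the integrated process -/

/-- Variation of constants: the integral `x` of a path of `X` solves
`x' = X 0 - α x + σ (B - B 0)`, `x 0 = 0`. -/
theorem integratedProcess_eq {Ω : Type*} {α σ : ℝ} {B X : ℝ≥0 → Ω → ℝ} {ω : Ω} (hα : α ≠ 0)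
    (hXc : Continuous fun t ↦ X t ω) (hBc : Continuous fun t ↦ B t ω)
    (hX : ∀ t : ℝ≥0, X t ω = X 0 ω + (∫ s in (0 : ℝ)..t, -α * X s.toNNReal ω)
      + σ * (B t ω - B 0 ω)) (t : ℝ≥0) :
    integratedProcess X t ω = responseKernel α t 0 * X 0 ω
      + σ * ∫ u in (0 : ℝ)..t, Real.exp (-α * (t - u)) * (B u.toNNReal ω - B 0 ω) := by
  set x : ℝ → ℝ := fun r ↦ ∫ s in (0 : ℝ)..r, X s.toNNReal ω with hx
  set b : ℝ → ℝ := fun r ↦ B r.toNNReal ω - B 0 ω with hb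
  have hXc' : Continuous fun s : ℝ ↦ X s.toNNReal ω := hXc.comp continuous_real_toNNReal
  have hbc : Continuous b := (hBc.comp continuous_real_toNNReal).sub continuous_const
  -- with the integrating factor `exp (α r)`, the unknown `x` disappears from the derivative
  have hd : ∀ r ∈ Set.uIcc (0 : ℝ) t, HasDerivAt (fun r ↦ Real.exp (α * r) * x r)
      (Real.exp (α * r) * X 0 ω + σ * (Real.exp (α * r) * b r)) r := by
    intro r hr
    rw [Set.uIcc_of_le t.coe_nonneg] at hr
    have h1 : HasDerivAt x (X r.toNNReal ω) r :=
      intervalIntegral.integral_hasDerivAt_right (hXc'.intervalIntegrable _ _)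
        (hXc'.stronglyMeasurableAtFilter _ _) hXc'.continuousAt
    have h2 := ((hasDerivAt_id r).const_mul α).exp.mul h1
    convert! h2 using 1
    have h3 := hX r.toNNReal
    rw [intervalIntegral.integral_const_mul, Real.coe_toNNReal r hr.1] at h3
    rw [h3]
    simp only [id_eq, hb, hx]
    ring
  have h := intervalIntegral.integral_eq_sub_of_hasDerivAt hd
    (Continuous.intervalIntegrable (by fun_prop) _ _)
  have hx0 : x 0 = 0 := by simp [hx]
  rw [hx0, mul_zero, sub_zero, intervalIntegral.integral_add
    (Continuous.intervalIntegrable (by fun_prop) _ _)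
    (Continuous.intervalIntegrable (by fun_prop) _ _), intervalIntegral.integral_mul_const,
    intervalIntegral.integral_const_mul] at h
  have h4 : ∫ r in (0 : ℝ)..t, Real.exp (α * r) = (Real.exp (α * t) - 1) / α := by
    rw [intervalIntegral.integral_comp_mul_left _ hα, integral_exp]
    simp [div_eq_inv_mul]
  have h5 : ∫ r in (0 : ℝ)..t, Real.exp (-α * (t - r)) * b r =
      Real.exp (-(α * t)) * ∫ r in (0 : ℝ)..t, Real.exp (α * r) * b r := by
    rw [← intervalIntegral.integral_const_mul]
    congr 1
    ext r
    rw [← mul_assoc, ← Real.exp_add]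
    ring_nf
  have h6 : Real.exp (-(α * t)) * Real.exp (α * t) = 1 := by rw [← Real.exp_add]; simp
  have h7 : integratedProcess X t ω = Real.exp (-(α * t)) * (Real.exp (α * t) * x t) := by
    rw [← mul_assoc, h6, one_mul]; rfl
  rw [h7, ← h, h4, h5, responseKernel_of_ge t.coe_nonneg]
  simp only [sub_zero, neg_mul]
  field_simp
  linear_combination (X 0 ω) * h6

open Filter Topology in
/-- The law of a linear combination of values of the integrated process. Any horizon `M` beyond the
times `τ i` may be used, as the response kernels vanish after their times. -/
theorem IsOrnsteinUhlenbeck.hasLaw_sum_integratedProcess {Ω : Type*} [MeasurableSpace Ω]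
    {μ : Measure Ω} [IsProbabilityMeasure μ] {α : ℝ} (hα : 0 < α) {B X : ℝ≥0 → Ω → ℝ}
    (hX : IsOrnsteinUhlenbeck α B X μ) {ι : Type*} [Fintype ι] (c : ι → ℝ) (τ : ι → ℝ≥0)
    {M : ℝ} (hM0 : 0 ≤ M) (hM : ∀ i, τ i ≤ M) :
    HasLaw (fun ω ↦ ∑ i, c i * integratedProcess X (τ i) ω)
      (gaussianReal 0 (Real.toNNReal (α ^ 2 * (∑ i, c i * responseKernel α (τ i) 0) ^ 2
        + α ^ 3 * ∫ u in (0 : ℝ)..M, (∑ i, c i * responseKernel α (τ i) u) ^ 2))) μ := by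
  set φ : ℝ → ℝ := fun u ↦ ∑ i, c i * responseKernel α (τ i) u with hφ
  have hφc : Continuous φ :=
    continuous_finsetSum _ fun i _ ↦ (continuous_responseKernel α (τ i)).const_mul _
  set σ := α ^ (3 / 2 : ℝ) with hσ
  have hσ2 : σ ^ 2 = α ^ 3 := by
    rw [hσ, ← Real.rpow_natCast, ← Real.rpow_mul hα.le, ← Real.rpow_natCast]
    norm_num
  -- one grid for all the times `τ i`, so that the approximating sums are jointly Gaussian
  set u : ℕ → ℕ → ℝ≥0 := fun n k ↦ (M * k / (n + 1)).toNNReal with hu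
  have hum : ∀ n, Monotone (u n) := fun n k l hkl ↦ by
    apply Real.toNNReal_le_toNNReal; gcongr
  set S : ℕ → Ω → ℝ := fun n ω ↦ ∑ k ∈ Finset.range (n + 1),
    φ (M * k / (n + 1)) * (B (u n (k + 1)) ω - B (u n k) ω) with hS
  set v : ℕ → ℝ≥0 := fun n ↦ ∑ k ∈ Finset.range (n + 1),
    Real.toNNReal (φ (M * k / (n + 1)) ^ 2) * (u n (k + 1) - u n k) with hv
  have hlawS : ∀ n, HasLaw (S n) (gaussianReal 0 (v n)) μ := fun n ↦
    hX.brownian.hasLaw_sum_increments (hum n) (fun k : ℕ ↦ φ (M * k / (n + 1))) (n + 1)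
  have hindep : ∀ n, IndepFun (fun ω ↦ φ 0 * X 0 ω) (fun ω ↦ σ * S n ω) μ := fun n ↦
    hX.initial_indep.comp (φ := fun x ↦ φ 0 * x)
      (ψ := fun p : ℝ≥0 → ℝ ↦ σ * ∑ k ∈ Finset.range (n + 1),
        φ (M * k / (n + 1)) * (p (u n (k + 1)) - p (u n k))) (by fun_prop) (by fun_prop)
  refine hasLaw_gaussianReal_of_tendsto_ae (U := fun n ω ↦ φ 0 * X 0 ω + σ * S n ω)
    (v := fun n ↦ .mk (φ 0 ^ 2) (sq_nonneg _) * Real.toNNReal (α ^ 2)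
      + .mk (σ ^ 2) (sq_nonneg _) * v n) (fun n ↦ ?_) ?_ ?_
  · have h1 := gaussianReal_const_mul hX.initial_law (φ 0)
    have h2 := gaussianReal_const_mul (hlawS n) σ
    have h := gaussianReal_add_gaussianReal_of_indepFun (hindep n) h1.map_eq h2.map_eq
    exact ⟨h1.aemeasurable.add h2.aemeasurable, by simpa [Pi.add_def] using h⟩
  · filter_upwards [hX.brownian.cont, hX.continuous_paths, hX.sde] with ω hBω hXω hsde
    have hlim : ∀ i, Tendsto (fun n : ℕ ↦ ∑ k ∈ Finset.range (n + 1),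
        responseKernel α (τ i) (M * k / (n + 1)) * (B (u n (k + 1)) ω - B (u n k) ω)) atTop
        (𝓝 (∫ r in (0 : ℝ)..τ i,
          Real.exp (-α * (τ i - r)) * (B r.toNNReal ω - B 0 ω))) := by
      intro i
      have h := tendsto_sum_responseKernel_mul_increment hα.ne' (τ i).2 (hM i)
        (b := fun r ↦ B r.toNNReal ω - B 0 ω)
        ((hBω.comp continuous_real_toNNReal).sub continuous_const).continuousOn (by simp)
      refine h.congr fun n ↦ Finset.sum_congr rfl fun k _ ↦ ?_
      simp [hu]
    have h := (tendsto_const_nhds (x := φ 0 * X 0 ω)).add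
      ((tendsto_finsetSum Finset.univ fun i _ ↦ (hlim i).const_mul (c i)).const_mul σ)
    convert! h using 2 with n
    · congr 2
      simp only [hS, hφ, Finset.mul_sum, Finset.sum_mul]
      rw [Finset.sum_comm]
      simp only [mul_assoc]
    · simp only [hφ, Finset.sum_mul, Finset.mul_sum, ← Finset.sum_add_distrib]
      refine Finset.sum_congr rfl fun i _ ↦ ?_
      rw [integratedProcess_eq hα.ne' hXω hBω hsde (τ i)]
      ring
  · have h := tendsto_sum_mul_integral hM0 (g := fun r ↦ φ r ^ 2) (w := fun _ ↦ 1)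
      (by fun_prop) (by simp) (fun n k ↦ M * k / (n + 1))
      (fun (n k : ℕ) _ ↦ ⟨by simp, by gcongr; linarith⟩)
    have hint : 0 ≤ ∫ r in (0 : ℝ)..M, φ r ^ 2 :=
      intervalIntegral.integral_nonneg hM0 fun _ _ ↦ sq_nonneg _
    rw [Real.coe_toNNReal _ (by positivity)]
    have h' := (tendsto_const_nhds (x := α ^ 2 * φ 0 ^ 2)).add (h.const_mul (α ^ 3))
    simp only [mul_one] at h'
    refine h'.congr fun n ↦ ?_
    have hvn : (v n : ℝ) = ∑ k ∈ Finset.range (n + 1), φ (M * k / (n + 1)) ^ 2 *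
        ∫ _ in (M * k / (n + 1))..(M * (k + 1) / ((n : ℝ) + 1)), (1 : ℝ) := by
      simp only [hv, NNReal.coe_sum, NNReal.coe_mul, NNReal.coe_sub (hum n (Nat.le_succ _))]
      refine Finset.sum_congr rfl fun k _ ↦ ?_
      rw [Real.coe_toNNReal _ (sq_nonneg _)]
      simp only [hu, intervalIntegral.integral_const, smul_eq_mul, mul_one]
      rw [Real.coe_toNNReal _ (by positivity), Real.coe_toNNReal _ (by positivity)]
      push_cast
      rfl
    push_cast
    rw [hvn, Real.coe_toNNReal _ (sq_nonneg _), hσ2]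
    ring

/-! ### Gaussianity and covariance of the discount process -/

theorem discountProcess_eq {Ω : Type*} (X : ℝ≥0 → Ω → ℝ) (f : ℝ) (t : ℝ≥0) :
    discountProcess f X t =
      fun ω ↦ Real.exp (-f * t) + Real.exp (-f * t) * integratedProcess X t ω := by
  ext ω
  simp only [discountProcess]
  ring

section
variable {Ω : Type*} [MeasurableSpace Ω] {μ : Measure Ω} [IsProbabilityMeasure μ] {α : ℝ}
  {B X : ℝ≥0 → Ω → ℝ}

theorem IsOrnsteinUhlenbeck.hasLaw_integratedProcess (hX : IsOrnsteinUhlenbeck α B X μ)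
    (hα : 0 < α) (t : ℝ≥0) :
    ∃ v : ℝ≥0, HasLaw (integratedProcess X t) (gaussianReal 0 v) μ := by
  have h := hX.hasLaw_sum_integratedProcess hα (fun _ : Unit ↦ (1 : ℝ)) (fun _ ↦ t) t.coe_nonneg
    (fun _ ↦ le_rfl)
  simp only [Finset.univ_unique, one_mul, Finset.sum_singleton] at h
  exact ⟨_, h⟩

theorem IsOrnsteinUhlenbeck.isGaussianProcess_integratedProcess
    (hX : IsOrnsteinUhlenbeck α B X μ) (hα : 0 < α) :
    IsGaussianProcess (integratedProcess X) μ where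
  hasGaussianLaw I := by
    have hm : AEMeasurable (fun ω ↦ I.restrict (integratedProcess X · ω)) μ :=
      aemeasurable_pi_lambda _ fun t ↦ (hX.hasLaw_integratedProcess hα t.1).choose_spec.aemeasurable
    -- every linear functional of the restriction to `I` is a linear combination of the values
    obtain ⟨M, hM⟩ := (I.image fun t : ℝ≥0 ↦ (t : ℝ)).bddAbove
    refine ⟨isGaussian_of_map_eq_gaussianReal fun L ↦ ?_⟩
    have h := hX.hasLaw_sum_integratedProcess hα (fun i : I ↦ L (Pi.single i 1)) (fun i ↦ i.1)
      (le_max_right M 0) (fun i ↦ (hM (by simp)).trans (le_max_left M 0))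
    refine ⟨0, _, Eq.trans ?_ h.map_eq⟩
    rw [AEMeasurable.map_map_of_aemeasurable (by fun_prop) hm]
    congr 1
    ext ω
    have e : I.restrict (integratedProcess X · ω) =
        ∑ i : I, integratedProcess X i.1 ω • Pi.single i (1 : ℝ) := by
      ext j
      simp [Finset.sum_apply, Pi.single_apply]
    simp only [Function.comp_apply]
    rw [e, map_sum]
    simp [mul_comm]

theorem IsOrnsteinUhlenbeck.variance_sum_integratedProcess (hX : IsOrnsteinUhlenbeck α B X μ)
    (hα : 0 < α) {ι : Type*} [Fintype ι] (c : ι → ℝ) (τ : ι → ℝ≥0)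
    {M : ℝ} (hM0 : 0 ≤ M) (hM : ∀ i, τ i ≤ M) :
    Var[fun ω ↦ ∑ i, c i * integratedProcess X (τ i) ω; μ] =
      α ^ 2 * (∑ i, c i * responseKernel α (τ i) 0) ^ 2
        + α ^ 3 * ∫ u in (0 : ℝ)..M, (∑ i, c i * responseKernel α (τ i) u) ^ 2 := by
  rw [(hX.hasLaw_sum_integratedProcess hα c τ hM0 hM).variance_eq, variance_id_gaussianReal,
    Real.coe_toNNReal]
  have : 0 ≤ ∫ u in (0 : ℝ)..M, (∑ i, c i * responseKernel α (τ i) u) ^ 2 :=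
    intervalIntegral.integral_nonneg hM0 fun _ _ ↦ sq_nonneg _
  positivity

theorem IsOrnsteinUhlenbeck.covariance_integratedProcess (hX : IsOrnsteinUhlenbeck α B X μ)
    (hα : 0 < α) (s t : ℝ≥0) :
    cov[integratedProcess X s, integratedProcess X t; μ] =
      α * min (s : ℝ) t - Real.exp (-α * max (s : ℝ) t) * Real.sinh (α * min (s : ℝ) t) := by
  have hG := hX.isGaussianProcess_integratedProcess hα
  set M : ℝ := max s t
  have hM0 : 0 ≤ M := s.coe_nonneg.trans (le_max_left _ _)
  have hvar := fun c : Fin 2 → ℝ ↦ hX.variance_sum_integratedProcess hα c ![s, t] hM0 (by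
    intro i; fin_cases i
    · exact le_max_left (s : ℝ) t
    · exact le_max_right (s : ℝ) t)
  -- polarization
  have h1 := hvar ![1, 1]
  have h2 := hvar ![1, 0]
  have h3 := hvar ![0, 1]
  simp only [Fin.sum_univ_two, Matrix.cons_val_zero, Matrix.cons_val_one, one_mul, zero_mul,
    add_zero, zero_add] at h1 h2 h3
  rw [variance_fun_add (hG.hasGaussianLaw_eval s).memLp_two (hG.hasGaussianLaw_eval t).memLp_two]
    at h1
  have hc : ∀ r : ℝ≥0, Continuous (responseKernel α r) := fun r ↦ continuous_responseKernel α r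
  have hcs := hc s
  have hct := hc t
  have e : ∫ u in (0 : ℝ)..M, (responseKernel α s u + responseKernel α t u) ^ 2 =
      (∫ u in (0 : ℝ)..M, responseKernel α s u ^ 2)
      + 2 * (∫ u in (0 : ℝ)..M, responseKernel α s u * responseKernel α t u)
      + ∫ u in (0 : ℝ)..M, responseKernel α t u ^ 2 := by
    rw [← intervalIntegral.integral_const_mul, ← intervalIntegral.integral_add,
      ← intervalIntegral.integral_add]
    · congr 1; ext u; ring
    all_goals exact Continuous.intervalIntegrable (by fun_prop) _ _
  rw [e] at h1
  rw [← responseKernel_gram hα s.coe_nonneg t.coe_nonneg (le_max_left (s : ℝ) t)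
    (le_max_right (s : ℝ) t)]
  linear_combination (h1 - h2 - h3) / 2

theorem IsOrnsteinUhlenbeck.isGaussianProcess_discountProcess
    (hX : IsOrnsteinUhlenbeck α B X μ) (hα : 0 < α) (f : ℝ) :
    IsGaussianProcess (discountProcess f X) μ where
  hasGaussianLaw I := by
    have h := ((hX.isGaussianProcess_integratedProcess hα).smul
      (fun t : ℝ≥0 ↦ Real.exp (-f * t))).hasGaussianLaw I
    have hg := h.isGaussian_map
    set c : I → ℝ := fun t ↦ Real.exp (-f * t.1)
    have h' : IsGaussian ((μ.map fun ω ↦ I.restrict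
        fun t ↦ Real.exp (-f * t) • integratedProcess X t ω).map (fun x ↦ c + x)) := inferInstance
    rw [AEMeasurable.map_map_of_aemeasurable (by fun_prop) h.aemeasurable] at h'
    constructor
    convert h' using 2
    ext ω t
    simp [discountProcess_eq, c]

theorem IsOrnsteinUhlenbeck.integral_discountProcess
    (hX : IsOrnsteinUhlenbeck α B X μ) (hα : 0 < α) (f : ℝ) (t : ℝ≥0) :
    μ[discountProcess f X t] = Real.exp (-f * t) := by
  obtain ⟨v, hv⟩ := hX.hasLaw_integratedProcess hα t
  have hi : Integrable (integratedProcess X t) μ := hv.hasGaussianLaw.integrable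
  have h0 : ∫ ω, integratedProcess X t ω ∂μ = 0 := by
    rw [hv.integral_eq, integral_id_gaussianReal]
  rw [discountProcess_eq, integral_add (integrable_const _) (hi.const_mul _), integral_const_mul,
    h0]
  simp

theorem IsOrnsteinUhlenbeck.covariance_discountProcess
    (hX : IsOrnsteinUhlenbeck α B X μ) (hα : 0 < α) (f : ℝ) (s t : ℝ≥0) :
    cov[discountProcess f X s, discountProcess f X t; μ] = wilsonKernel α f s t := by
  have hi : ∀ r : ℝ≥0, Integrable (fun ω ↦ Real.exp (-f * r) * integratedProcess X r ω) μ := fun r ↦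
    (((hX.isGaussianProcess_integratedProcess hα).hasGaussianLaw_eval r).integrable).const_mul _
  rw [discountProcess_eq, discountProcess_eq, covariance_const_add_left (hi s),
    covariance_const_add_right (hi t), covariance_const_mul_left, covariance_const_mul_right,
    hX.covariance_integratedProcess hα, wilsonKernel, mul_add, Real.exp_add]
  ring

theorem IsOrnsteinUhlenbeck.posDef_wilsonKernel (hX : IsOrnsteinUhlenbeck α B X μ) (hα : 0 < α)
    (f : ℝ) {ι : Type*} [Fintype ι] {T : ι → ℝ≥0} (hT : Function.Injective T)
    (hT0 : ∀ i, 0 < T i) :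
    (Matrix.of fun i j ↦ wilsonKernel α f (T i) (T j)).PosDef := by
  refine Matrix.PosDef.of_dotProduct_mulVec_pos ?_ fun {c} hc ↦ ?_
  · ext i j
    simp [wilsonKernel, add_comm, min_comm, max_comm]
  have hI := hX.isGaussianProcess_integratedProcess hα
  have hL2 : ∀ i, MemLp (fun ω ↦ (c i * Real.exp (-f * T i)) * integratedProcess X (T i) ω) 2 μ :=
    fun i ↦ (hI.hasGaussianLaw_eval (T i)).memLp_two.const_mul _
  obtain ⟨M, hM⟩ := (Finset.univ.image fun i ↦ (T i : ℝ)).bddAbove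
  have hM' : ∀ i, (T i : ℝ) ≤ M := fun i ↦ hM (by simp)
  obtain ⟨i₀, -⟩ := Function.ne_iff.1 hc
  have hM0 : 0 ≤ M := (T i₀).coe_nonneg.trans (hM' i₀)
  have h1 : star c ⬝ᵥ ((Matrix.of fun i j ↦ wilsonKernel α f (T i) (T j)) *ᵥ c) =
      Var[fun ω ↦ ∑ i, (c i * Real.exp (-f * T i)) * integratedProcess X (T i) ω; μ] := by
    rw [← covariance_self (Finset.aemeasurable_fun_sum _ fun i _ ↦ (hL2 i).aemeasurable),
      covariance_fun_sum_fun_sum hL2 hL2]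
    simp only [dotProduct, Matrix.mulVec, Matrix.of_apply, Finset.mul_sum,
      covariance_const_mul_left, covariance_const_mul_right, hX.covariance_integratedProcess hα]
    refine Finset.sum_congr rfl fun i _ ↦ Finset.sum_congr rfl fun j _ ↦ ?_
    simp only [Pi.star_apply, star_trivial, wilsonKernel, mul_add, Real.exp_add]
    ring
  rw [h1, hX.variance_sum_integratedProcess hα _ _ hM0 hM']
  have h2 := integral_sq_sum_responseKernel_pos hα (NNReal.coe_injective.comp hT)
    (fun i ↦ NNReal.coe_pos.2 (hT0 i)) hM' (c := fun i ↦ c i * Real.exp (-f * T i)) (by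
      intro h
      refine hc (funext fun i ↦ ?_)
      simpa [Real.exp_ne_zero] using congrFun h i)
  simp only [Function.comp_apply] at h2
  positivity
end

/-! ### Conditioning and full support of Gaussian vectors -/

section
open Matrix
variable {Ω : Type*} [MeasurableSpace Ω] {P : Measure Ω} {ι : Type*} [Fintype ι]

/-- If `a` solves the normal equations, the regression residual is independent of the regressors. -/
theorem ProbabilityTheory.HasGaussianLaw.indepFun_sub_linear
    {Z : Ω → ℝ} {V : ι → Ω → ℝ} (h : HasGaussianLaw (fun ω ↦ (Z ω, fun i ↦ V i ω)) P) (a : ι → ℝ)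
    (hcov : ∀ j, cov[Z, V j; P] = ∑ i, a i * cov[V i, V j; P]) :
    IndepFun (fun ω ↦ Z ω - ∑ i, a i * V i ω) (fun ω i ↦ V i ω) P := by
  have := h.isProbabilityMeasure
  have hV2 : ∀ i, MemLp (V i) 2 P := fun i ↦ (h.snd.eval i).memLp_two
  have hZ2 : MemLp Z 2 P := h.fst.memLp_two
  let L : ℝ × (ι → ℝ) →L[ℝ] (Unit → ℝ) × (ι → ℝ) :=
    (ContinuousLinearMap.pi fun _ ↦ ContinuousLinearMap.fst ℝ ℝ (ι → ℝ)
      - ∑ i, a i • (ContinuousLinearMap.proj (R := ℝ) (φ := fun _ : ι ↦ ℝ) i).comp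
        (ContinuousLinearMap.snd ℝ ℝ (ι → ℝ))).prod (ContinuousLinearMap.snd ℝ ℝ (ι → ℝ))
  have hL : HasGaussianLaw
      (fun ω ↦ ((fun _ : Unit ↦ Z ω - ∑ i, a i * V i ω), fun i ↦ V i ω)) P := by
    have e : (fun ω ↦ ((fun _ : Unit ↦ Z ω - ∑ i, a i * V i ω), fun i ↦ V i ω)) =
        fun ω ↦ L (Z ω, fun i ↦ V i ω) := by
      ext ω <;> simp [L]
    rw [e]
    exact h.map_fun L
  have hind := HasGaussianLaw.indepFun_of_covariance_eval
    (X := fun _ : Unit ↦ fun ω ↦ Z ω - ∑ i, a i * V i ω) hL fun _ j ↦ by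
      rw [covariance_fun_sub_left hZ2
        (memLp_finsetSum _ fun i _ ↦ (hV2 i).const_mul (a i)) (hV2 j),
        covariance_fun_sum_left (fun i ↦ (hV2 i).const_mul (a i)) (hV2 j), hcov j]
      simp [covariance_const_mul_left]
  exact hind.comp (φ := fun x : Unit → ℝ ↦ x ()) (ψ := id) (by fun_prop) measurable_id

/-- If `Z` is a function `g` of `V` plus noise of mean zero independent of `V`, then `g` is the mean
of the conditional distribution of `Z` given `V`. -/
theorem ae_eq_integral_condDistrib_of_indepFun [IsProbabilityMeasure P] {E : Type*}
    [MeasurableSpace E] {Z : Ω → ℝ} {V : Ω → E} {g : E → ℝ} (hV : AEMeasurable V P)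
    (hg : Measurable g) (hgV : Integrable (fun ω ↦ g (V ω)) P) (hZ : Integrable Z P)
    (hmean : P[Z] = ∫ ω, g (V ω) ∂P) (hind : IndepFun (fun ω ↦ Z ω - g (V ω)) V P) :
    ∀ᵐ y ∂(P.map V), g y = ∫ z, z ∂(condDistrib Z V P y) := by
  -- conditional expectations need a sub-σ-algebra, so `V` and the residual are replaced by
  -- measurable modifications
  have hV' := hV.measurable_mk
  have hVae := hV.ae_eq_mk
  set V' := hV.mk V
  have hR : Integrable (fun ω ↦ Z ω - g (V' ω)) P := by
    refine (hZ.sub hgV).congr ?_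
    filter_upwards [hVae] with ω hω
    simp [hω]
  have hgV' : Integrable (fun ω ↦ g (V' ω)) P :=
    hgV.congr (hVae.mono fun ω hω ↦ by simp only [hω])
  have hRm := hR.aestronglyMeasurable.stronglyMeasurable_mk
  have hRae := hR.aestronglyMeasurable.ae_eq_mk
  set R := hR.aestronglyMeasurable.mk _
  have hind' : IndepFun R V' P := by
    refine hind.congr ?_ hVae
    filter_upwards [hVae, hRae] with ω hω hω'
    rw [← hω', hω]
  have h0 : ∫ ω, R ω ∂P = 0 := by
    rw [← integral_congr_ae hRae, integral_sub hZ hgV', hmean, sub_eq_zero]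
    exact integral_congr_ae (hVae.mono fun ω hω ↦ by simp only [hω])
  rw [condDistrib_congr_right hVae, Measure.map_congr hVae,
    ae_map_iff hV'.aemeasurable (measurableSet_eq_fun hg ?_)]
  · have h1 := condExp_ae_eq_integral_condDistrib' hV' hZ
    have h2 : P[R | MeasurableSpace.comap V' inferInstance] =ᵐ[P] fun _ ↦ ∫ ω, R ω ∂P :=
      condExp_indep_eq hRm.measurable.comap_le hV'.comap_le
        (comap_measurable R).stronglyMeasurable hind'
    have h3 : P[fun ω ↦ g (V' ω) | MeasurableSpace.comap V' inferInstance] = fun ω ↦ g (V' ω) :=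
      condExp_of_stronglyMeasurable hV'.comap_le
        (hg.comp (comap_measurable V')).stronglyMeasurable hgV'
    have h4 : Z =ᵐ[P] R + fun ω ↦ g (V' ω) := by
      filter_upwards [hRae] with ω hω
      simp [← hω]
    have h5 := condExp_add (hR.congr hRae) hgV' (MeasurableSpace.comap V' inferInstance)
    have h6 := condExp_congr_ae (m := MeasurableSpace.comap V' inferInstance) h4
    rw [h3] at h5
    filter_upwards [h1, h2, h5, h6] with ω h1 h2 h5 h6
    rw [← h1, h6, h5, Pi.add_apply, h2, h0, zero_add]
  · have : StronglyMeasurable fun y ↦ ∫ z, z ∂(condDistrib Z V' P y) :=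
      StronglyMeasurable.integral_condDistrib (f := fun p : E × ℝ ↦ p.2)
        measurable_snd.stronglyMeasurable
    exact this.measurable

theorem isOpenPosMeasure_gaussianReal (m : ℝ) {v : ℝ≥0} (hv : v ≠ 0) :
    (gaussianReal m v).IsOpenPosMeasure :=
  (gaussianReal_absolutelyContinuous' m hv).isOpenPosMeasure

/-- A Gaussian vector with positive definite covariance matrix has full support. -/
theorem ProbabilityTheory.HasGaussianLaw.isOpenPosMeasure_map [DecidableEq ι] {V : ι → Ω → ℝ}
    (h : HasGaussianLaw (fun ω i ↦ V i ω) P)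
    (hS : (Matrix.of fun i j ↦ cov[V i, V j; P]).PosDef) :
    (P.map fun ω i ↦ V i ω).IsOpenPosMeasure := by
  have := h.isProbabilityMeasure
  set S : Matrix ι ι ℝ := Matrix.of fun i j ↦ cov[V i, V j; P] with hSdef
  have hV2 : ∀ i, MemLp (V i) 2 P := fun i ↦ (h.eval i).memLp_two
  -- a whitening matrix: the vector `W = A V` has identity covariance
  obtain ⟨A, hA, hA'⟩ : ∃ A : Matrix ι ι ℝ, IsUnit A.det ∧ A * S * Aᵀ = 1 := by
    open scoped MatrixOrder in
    obtain ⟨b, hb⟩ := CStarAlgebra.nonneg_iff_eq_star_mul_self.1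
      (Matrix.nonneg_iff_posSemidef.2 hS.posSemidef)
    rw [Matrix.star_eq_conjTranspose, Matrix.conjTranspose_eq_transpose_of_trivial] at hb
    have hbdet : IsUnit b.det := by
      have := hS.det_pos
      rw [hb, Matrix.det_mul, Matrix.det_transpose] at this
      exact isUnit_iff_ne_zero.2 fun h0 ↦ by simp [h0] at this
    refine ⟨(b⁻¹)ᵀ, ?_, ?_⟩
    · rw [Matrix.det_transpose]
      exact Matrix.isUnit_nonsing_inv_det b hbdet
    · rw [Matrix.transpose_transpose, hb, ← Matrix.mul_assoc, ← Matrix.transpose_mul,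
        Matrix.mul_nonsing_inv b hbdet, Matrix.transpose_one, Matrix.one_mul,
        Matrix.mul_nonsing_inv b hbdet]
  set W : ι → Ω → ℝ := fun i ω ↦ ∑ j, A i j * V j ω with hW
  have hWlaw : HasGaussianLaw (fun ω i ↦ W i ω) P := by
    exact h.map_fun (LinearMap.toContinuousLinearMap (Matrix.toLin' A))
  have hWcov : ∀ i j, cov[W i, W j; P] = (1 : Matrix ι ι ℝ) i j := by
    intro i j
    rw [covariance_fun_sum_fun_sum (fun k ↦ (hV2 k).const_mul _) (fun k ↦ (hV2 k).const_mul _),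
      ← hA']
    simp only [covariance_const_mul_left, covariance_const_mul_right, Matrix.mul_apply,
      Matrix.transpose_apply, Finset.sum_mul]
    rw [Finset.sum_comm]
    refine Finset.sum_congr rfl fun k _ ↦ Finset.sum_congr rfl fun l _ ↦ ?_
    simp only [hSdef, Matrix.of_apply]
    ring
  have hind : iIndepFun W P := hWlaw.iIndepFun_of_covariance_eq_zero fun i j hij ↦ by
    rw [hWcov, Matrix.one_apply_ne hij]
  have hWm : ∀ i, AEMeasurable (W i) P := fun i ↦ (hWlaw.eval i).aemeasurable
  have hpi : P.map (fun ω i ↦ W i ω) = Measure.pi fun i ↦ P.map (W i) :=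
    (iIndepFun_iff_map_fun_eq_pi_map hWm).1 hind
  have hopen : ∀ i, (P.map (W i)).IsOpenPosMeasure := fun i ↦ by
    rw [(hWlaw.eval i).map_eq_gaussianReal]
    refine isOpenPosMeasure_gaussianReal _ ?_
    rw [← covariance_self (hWm i), hWcov]
    simp
  have hprob : ∀ i, IsProbabilityMeasure (P.map (W i)) := fun i ↦
    Measure.isProbabilityMeasure_map (hWm i)
  have hopenW : (P.map fun ω i ↦ W i ω).IsOpenPosMeasure := by
    rw [hpi]; infer_instance
  have hsurj : Function.Surjective (fun x : ι → ℝ ↦ A⁻¹ *ᵥ x) := fun y ↦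
    ⟨A *ᵥ y, by
      change A⁻¹ *ᵥ (A *ᵥ y) = y
      rw [Matrix.mulVec_mulVec, Matrix.nonsing_inv_mul A hA, Matrix.one_mulVec]⟩
  have hcont : Continuous (fun x : ι → ℝ ↦ A⁻¹ *ᵥ x) := by fun_prop
  have e : (fun ω i ↦ V i ω) = (fun x : ι → ℝ ↦ A⁻¹ *ᵥ x) ∘ fun ω i ↦ W i ω := by
    ext ω i
    have : (fun i ↦ W i ω) = A *ᵥ fun i ↦ V i ω := rfl
    rw [Function.comp_apply, this, Matrix.mulVec_mulVec, Matrix.nonsing_inv_mul A hA,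
      Matrix.one_mulVec]
  rw [e, ← AEMeasurable.map_map_of_aemeasurable hcont.measurable.aemeasurable hWlaw.aemeasurable]
  exact hcont.isOpenPosMeasure_map hsurj
end

section
variable {Ω : Type*} [MeasurableSpace Ω]

/-- Finitely many values of a Gaussian process, possibly with repeated times, are jointly
Gaussian. -/
theorem ProbabilityTheory.IsGaussianProcess.hasGaussianLaw_family {P : Measure Ω} {T ι : Type*}
    [Fintype ι] {Y : T → Ω → ℝ} (hY : IsGaussianProcess Y P) (τ : ι → T) :
    HasGaussianLaw (fun ω i ↦ Y (τ i) ω) P := by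
  classical
  exact (hY.hasGaussianLaw (Finset.univ.image τ)).map_fun (ContinuousLinearMap.pi fun i ↦
    ContinuousLinearMap.proj (R := ℝ) (φ := fun _ : Finset.univ.image τ ↦ ℝ) ⟨τ i, by simp⟩)

/-- Gaussian regression: if `a` solves the normal equations, then the affine function with slopes
`a` through the means is a continuous version of `y ↦ E[Z | V = y]`. -/
theorem ProbabilityTheory.HasGaussianLaw.isContinuousCondMean {N : ℕ} {P : Measure Ω}
    [IsProbabilityMeasure P] {Z : Ω → ℝ} {V : Fin N → Ω → ℝ}
    (h : HasGaussianLaw (fun ω ↦ (Z ω, fun i ↦ V i ω)) P) (a : Fin N → ℝ)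
    (hcov : ∀ j, cov[Z, V j; P] = ∑ i, a i * cov[V i, V j; P]) :
    IsContinuousCondMean P Z (fun ω i ↦ V i ω) fun y ↦ P[Z] + ∑ i, a i * (y i - P[V i]) := by
  have hV : ∀ i, Integrable (V i) P := fun i ↦ (h.snd.eval i).integrable
  have haV : ∀ i, Integrable (fun ω ↦ a i * (V i ω - P[V i])) P := fun i ↦
    ((hV i).sub (integrable_const _)).const_mul (a i)
  have hc : Continuous fun y : Fin N → ℝ ↦ P[Z] + ∑ i, a i * (y i - P[V i]) := by fun_prop
  refine ⟨hc, ae_eq_integral_condDistrib_of_indepFun h.snd.aemeasurable hc.measurable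
    ((integrable_const _).add (integrable_finsetSum _ fun i _ ↦ haV i)) h.fst.integrable ?_ ?_⟩
  · rw [integral_add (integrable_const _) (integrable_finsetSum _ fun i _ ↦ haV i),
      integral_finsetSum _ fun i _ ↦ haV i]
    simp_rw [integral_const_mul, integral_sub (hV _) (integrable_const _)]
    simp
  · have hind := (h.indepFun_sub_linear a hcov).comp
      (φ := fun r ↦ r - (P[Z] - ∑ i, a i * P[V i])) (ψ := id) (by fun_prop) measurable_id
    have e : (fun ω ↦ Z ω - (P[Z] + ∑ i, a i * (V i ω - P[V i]))) =
        (fun r ↦ r - (P[Z] - ∑ i, a i * P[V i])) ∘ fun ω ↦ Z ω - ∑ i, a i * V i ω := by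
      ext ω
      simp only [Function.comp_apply, mul_sub, Finset.sum_sub_distrib]
      ring
    rw [e]
    exact hind

theorem IsContinuousCondMean.unique {N : ℕ} {P : Measure Ω} [IsFiniteMeasure P] {Z : Ω → ℝ}
    {V : Ω → Fin N → ℝ} [(P.map V).IsOpenPosMeasure] {g g' : (Fin N → ℝ) → ℝ}
    (hg : IsContinuousCondMean P Z V g) (hg' : IsContinuousCondMean P Z V g') : g = g' := by
  refine (Continuous.ae_eq_iff_eq (P.map V) hg.continuous hg'.continuous).1 ?_
  filter_upwards [hg.ae_eq, hg'.ae_eq] with y h h'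
  rw [h, h']

end

/-! ### Smith-Wilson discount factors -/

theorem isSmithWilsonFit_iff {N : ℕ} {α f : ℝ} {T : Fin N → ℝ≥0} {D ζ : Fin N → ℝ} :
    IsSmithWilsonFit α f T D ζ ↔
      (Matrix.of fun i j ↦ wilsonKernel α f (T i) (T j)) *ᵥ ζ =
        fun i ↦ D i - Real.exp (-f * T i) := by
  simp only [IsSmithWilsonFit, smithWilsonDiscount, funext_iff, Matrix.mulVec, dotProduct,
    Matrix.of_apply, eq_sub_iff_add_eq']

theorem existsUnique_isSmithWilsonFit {N : ℕ} {α f : ℝ} {T : Fin N → ℝ≥0}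
    (hS : IsUnit (Matrix.of fun i j ↦ wilsonKernel α f (T i) (T j))) (D : Fin N → ℝ) :
    ∃! ζ : Fin N → ℝ, IsSmithWilsonFit α f T D ζ := by
  simp only [isSmithWilsonFit_iff]
  exact Function.Bijective.existsUnique
    ⟨Matrix.mulVec_injective_iff_isUnit.2 hS, Matrix.mulVec_surjective_iff_isUnit.2 hS⟩ _

theorem mainTheorem7 {Ω : Type*} [MeasurableSpace Ω] (μ : Measure Ω) [IsProbabilityMeasure μ]
    (α f : ℝ) (hα : 0 < α) (B X : ℝ≥0 → Ω → ℝ) (hX : IsOrnsteinUhlenbeck α B X μ) :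
    IsGaussianProcess (discountProcess f X) μ ∧
    (∀ t, MemLp (discountProcess f X t) 2 μ) ∧
    (∀ s t : ℝ≥0,
      cov[discountProcess f X s, discountProcess f X t; μ] = wilsonKernel α f s t) ∧
    ∀ (N : ℕ) (T : Fin N → ℝ≥0), Function.Injective T → (∀ i, 0 < T i) →
      (∀ D : Fin N → ℝ, ∃! ζ : Fin N → ℝ, IsSmithWilsonFit α f T D ζ) ∧
      ∀ t : ℝ≥0,
        ∃ g : (Fin N → ℝ) → ℝ,
          IsContinuousCondMean μ (discountProcess f X t)
            (fun ω i ↦ discountProcess f X (T i) ω) g ∧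
          (∀ g' : (Fin N → ℝ) → ℝ,
            IsContinuousCondMean μ (discountProcess f X t)
              (fun ω i ↦ discountProcess f X (T i) ω) g' → g' = g) ∧
          ∀ D ζ : Fin N → ℝ, IsSmithWilsonFit α f T D ζ →
            smithWilsonDiscount α f T ζ t = g D := by
  have hG := hX.isGaussianProcess_discountProcess hα f
  have hcov := hX.covariance_discountProcess hα f
  have hmean := hX.integral_discountProcess hα f
  refine ⟨hG, fun t ↦ (hG.hasGaussianLaw_eval t).memLp_two, hcov, fun N T hT hT0 ↦ ?_⟩
  have hS := hX.posDef_wilsonKernel hα f hT hT0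
  refine ⟨existsUnique_isSmithWilsonFit hS.isUnit, fun t ↦ ?_⟩
  -- the regression coefficients of `Y t` on the observed values
  obtain ⟨a, ha⟩ : ∃ a : Fin N → ℝ,
      a ᵥ* (Matrix.of fun i j ↦ wilsonKernel α f (T i) (T j)) =
        fun j ↦ wilsonKernel α f t (T j) :=
    Matrix.vecMul_surjective_iff_isUnit.2 hS.isUnit _
  have hpair : HasGaussianLaw
      (fun ω ↦ (discountProcess f X t ω, fun i ↦ discountProcess f X (T i) ω)) μ :=
    (hG.hasGaussianLaw_family fun o : Option (Fin N) ↦ o.elim t T).map_fun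
      ((ContinuousLinearMap.proj (R := ℝ) (φ := fun _ : Option (Fin N) ↦ ℝ) none).prod
        (ContinuousLinearMap.pi fun i ↦ ContinuousLinearMap.proj (R := ℝ)
          (φ := fun _ : Option (Fin N) ↦ ℝ) (some i)))
  have hcond := hpair.isContinuousCondMean
    (V := fun i ω ↦ discountProcess f X (T i) ω) a fun j ↦ by
      have := congrFun ha j
      simp only [Matrix.vecMul, dotProduct, Matrix.of_apply] at this
      simp only [hcov, this]
  have hopen : (μ.map fun ω i ↦ discountProcess f X (T i) ω).IsOpenPosMeasure :=
    HasGaussianLaw.isOpenPosMeasure_map (V := fun i ω ↦ discountProcess f X (T i) ω)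
      (hG.hasGaussianLaw_family T) (by simpa only [hcov] using hS)
  refine ⟨_, hcond, fun g' hg' ↦ hg'.unique hcond, fun D ζ hζ ↦ ?_⟩
  -- with the kernel vector written as `a ᵥ* S`, both sides are `exp (-f t) + a ⬝ᵥ (S *ᵥ ζ)`
  rw [isSmithWilsonFit_iff] at hζ
  have h1 : ∑ i, wilsonKernel α f t (T i) * ζ i =
      (a ᵥ* (Matrix.of fun i j ↦ wilsonKernel α f (T i) (T j))) ⬝ᵥ ζ := by rw [ha]; rfl
  rw [smithWilsonDiscount, h1, ← Matrix.dotProduct_mulVec, hζ, hmean t]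
  simp only [hmean]
  rfl
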